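/- Let $M$ be a commutative cancellative monoid. For $x \in M$ let $\mathsf L(x)$ be the set of all $k$ such that $x$ is a product of $k$ atoms (irreducible elements) of $M$, and let $\Delta(x)$ be the set of all differences $m'-m$ of consecutive elements $m<m'$ of $\mathsf L(x)$. Let $M$ be a Krull monoid: there are a free abelian monoid $D$ and a monoid homomorphism $\varphi\colon M\to D$ such that $\varphi(a)\mid\varphi(b)$ in $D$ implies $a\mid b$ in $M$, and every $\alpha\in D$ is of the form $\alpha=\gcd\{\varphi(a_1),\dots,\varphi(a_k)\}$ with $k\ge 1$ and $a_1,\dots,a_k\in M$. Assume that its class group $D/\varphi(M)$ (the group of classes of elements of $D$, where $\alpha\sim\beta$ if and only if $\varphi(a)\alpha=\varphi(b)\beta$ for some $a,b\in M$) is cyclic of order $n\ge 3$. If $T$ is a nonempty subset of $\{1,\dots,n-2\}$ with $n-2\in T$ but $T\ne\{n-2\}$, then $T$ is not realizable in $\Delta(M)$; that is, there is no $x\in M$ with $\Delta(x)=T$. -/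

import Mathlib

namespace KrullMonoid

/-- The set of lengths `L(x)`: all `k` such that `x` is a product of `k` atoms
(`Irreducible` elements) of `M`. -/
def lengthSet {M : Type*} [CancelCommMonoid M] (x : M) : Set ℕ :=
  {k | ∃ s : Multiset M, (∀ a ∈ s, Irreducible a) ∧ s.prod = x ∧ Multiset.card s = k}

/-- The delta set `Δ(x)`: all differences `d = m' - m > 0` of two consecutive elements
`m < m' = m + d` of `L(x)`. It is empty if `x` is a unit, since then `L(x) ⊆ {0}`. -/
def deltaSet {M : Type*} [CancelCommMonoid M] (x : M) : Set ℕ :=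
  {d | 0 < d ∧ ∃ m : ℕ, m ∈ lengthSet x ∧ m + d ∈ lengthSet x ∧
    ∀ k : ℕ, m < k → k < m + d → k ∉ lengthSet x}

/-- `T` is realizable in `Δ(M)` if it is the delta set of an element of `M`. -/
def IsRealizable (M : Type*) [CancelCommMonoid M] (T : Set ℕ) : Prop :=
  ∃ x : M, deltaSet x = T

/-- The free abelian monoid `F(P)` with basis `P`, written multiplicatively. -/
abbrev FreeAbelianMonoid (P : Type*) : Type _ := Multiplicative (Multiset P)

/-- A Krull monoid structure on the commutative cancellative monoid `M`, with set `P` of prime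
divisors: a homomorphism `φ : M → D` into the free abelian monoid `D = F(P)` such that
* `φ(a) ∣ φ(b)` in `D` implies `a ∣ b` in `M`;
* every `α ∈ D` is the greatest common divisor of `φ(a₁), …, φ(aₖ)` for some nonempty finite
  family of elements `aᵢ ∈ M` (a gcd in `D` is unique, because `1` is the only unit of `D`).

`M` is a Krull monoid if and only if it has such a structure for some `P`. -/
structure DivisorTheory (M : Type*) [CancelCommMonoid M] (P : Type*) where
  toHom : M →* FreeAbelianMonoid P
  dvd_of_map_dvd : ∀ a b : M, toHom a ∣ toHom b → a ∣ b
  exists_gcd : ∀ α : FreeAbelianMonoid P, ∃ s : Finset M, s.Nonempty ∧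
    (∀ a ∈ s, α ∣ toHom a) ∧
    ∀ β : FreeAbelianMonoid P, (∀ a ∈ s, β ∣ toHom a) → β ∣ α

namespace DivisorTheory

variable {M : Type*} [CancelCommMonoid M] {P : Type*} (φ : DivisorTheory M P)

/-- Congruence of elements of `D` modulo `φ(M)`: `α ~ β` iff `φ(a) α = φ(b) β` for some
`a, b ∈ M`, that is, iff `α` and `β` have the same image in the quotient `q(D) / q(φ(M))` of the
groups of fractions. -/
def classCon : Con (FreeAbelianMonoid P) where
  r α β := ∃ a b : M, φ.toHom a * α = φ.toHom b * β
  iseqv :=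
    { refl := fun _ => ⟨1, 1, rfl⟩
      symm := fun ⟨a, b, h⟩ => ⟨b, a, h.symm⟩
      trans := by
        rintro α β γ ⟨a, b, h⟩ ⟨c, d, h'⟩
        refine ⟨c * a, b * d, ?_⟩
        rw [map_mul, map_mul, mul_assoc, h, mul_left_comm, h', mul_assoc] }
  mul' := by
    rintro α β γ δ ⟨a, b, h⟩ ⟨c, d, h'⟩
    refine ⟨a * c, b * d, ?_⟩
    rw [map_mul, map_mul, mul_mul_mul_comm, h, h', mul_mul_mul_comm]

/-- The class group `D / φ(M)`. -/
def ClassGroup : Type _ := φ.classCon.Quotient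

instance : CommMonoid φ.ClassGroup := inferInstanceAs (CommMonoid φ.classCon.Quotient)

/-- The class in `D / φ(M)` of an element of `D`. -/
def toClass : FreeAbelianMonoid P →* φ.ClassGroup := φ.classCon.mk'

theorem exists_inv (x : φ.ClassGroup) : ∃ y : φ.ClassGroup, y * x = 1 := by
  obtain ⟨α, rfl⟩ : ∃ α, φ.toClass α = x := Con.mk'_surjective x
  obtain ⟨s, ⟨a, ha⟩, hs, -⟩ := φ.exists_gcd α
  obtain ⟨β, hβ⟩ := hs a ha
  refine ⟨φ.toClass β, ?_⟩
  rw [← map_mul, ← map_one φ.toClass]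
  refine φ.classCon.eq.2 ⟨1, a, ?_⟩
  rw [map_one, one_mul, mul_one, hβ, mul_comm]

/-- `D / φ(M)` is an abelian group. -/
noncomputable instance : CommGroup φ.ClassGroup where
  inv x := (φ.exists_inv x).choose
  inv_mul_cancel x := (φ.exists_inv x).choose_spec

end DivisorTheory

end KrullMonoid

/-! Sending an element to the sequence of classes of its prime divisors preserves the lengths of
nonunits (`IsTransfer.lengthSet_eq`), so the question concerns factorizations of zero-sum sequences
over a group `G` of order `n` into minimal ones, called atoms below. It suffices that one gap of
size `n - 2` makes all lengths congruent modulo `n - 2` (`dvd_sub_of_gap`): every element of the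
delta set is then a positive multiple of `n - 2` that is at most `n - 2`.

Atoms have at most `n` terms, with equality only for `gⁿ` where `g` generates `G`. Given
factorizations at both ends of the gap, an atom `U` of the short one is covered by at most `|U|`
atoms of the long one. Exchanging these for `U` and a factorization of the remaining terms gives a
new length. Either it is still large, and `U` can be cancelled, or it drops across the whole gap.
Such a drop is possible only as the exchange of `(g(-g))ⁿ` for `gⁿ(-g)ⁿ`
(`exists_generator_of_gap`).

For each other atom `A` of the resulting short factorization, `A gⁿ(-g)ⁿ` has no length strictly
between `3` and `n + 1`. A term `a • g` of `A` with `2 ≤ a ≤ n - 2` would produce one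
(`IsMinZeroSum.mem_eq_of_lengths`), so the whole sequence lives on `{0, g, -g}`. The only atoms
there are `0`, `g(-g)`, `gⁿ` and `(-g)ⁿ`, and a count shows that the length modulo `n - 2` depends
only on the sequence (`exists_excess`). -/

namespace KrullMonoid

/-- A minimal zero-sum sequence over `G`. -/
def IsMinZeroSum {G : Type*} [AddCommGroup G] (A : Multiset G) : Prop :=
  A ≠ 0 ∧ A.sum = 0 ∧ ∀ B ≤ A, B ≠ 0 → B.sum = 0 → B = A

/-- The set of lengths of factorizations of `B` into minimal zero-sum sequences. -/
def zeroSumLengths {G : Type*} [AddCommGroup G] (B : Multiset G) : Set ℕ :=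
  {k | ∃ z : Multiset (Multiset G), (∀ A ∈ z, IsMinZeroSum A) ∧ z.sum = B ∧ Multiset.card z = k}

theorem exists_add_of_map_eq_add {α β : Type*} (f : α → β) (s : Multiset α) (t u : Multiset β)
    (h : s.map f = t + u) : ∃ v w, s = v + w ∧ v.map f = t ∧ w.map f = u := by
  classical
  induction t using Multiset.induction_on generalizing s with
  | empty => exact ⟨0, s, by simp, by simp, by simpa using h⟩
  | cons b t ih =>
    have hb : b ∈ s.map f := by rw [h]; simp
    obtain ⟨a, ha, rfl⟩ := Multiset.mem_map.1 hb
    obtain ⟨s, rfl⟩ := Multiset.exists_cons_of_mem ha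
    simp only [Multiset.map_cons, Multiset.cons_add] at h
    obtain ⟨v, w, rfl, rfl, rfl⟩ := ih s ((Multiset.cons_inj_right _).1 h)
    exact ⟨a ::ₘ v, w, by simp, by simp, rfl⟩

/-! ### Transfer homomorphisms preserve lengths -/

section Transfer

variable {M : Type*} [CancelCommMonoid M] {G : Type*} [AddCommGroup G]

/-- A transfer homomorphism from `M` to the monoid of zero-sum sequences over `G`. -/
structure IsTransfer (θ : M → Multiset G) : Prop where
  map_mul : ∀ a b, θ (a * b) = θ a + θ b
  map_one : θ 1 = 0
  isUnit_of_eq_zero : ∀ a, θ a = 0 → IsUnit a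
  sum_eq_zero : ∀ a, (θ a).sum = 0
  exists_mul : ∀ x B C, θ x = B + C → B.sum = 0 → ∃ a b, x = a * b ∧ θ a = B ∧ θ b = C

namespace IsTransfer

variable {θ : M → Multiset G} (h : IsTransfer θ)
include h

theorem eq_zero_of_isUnit {a : M} (ha : IsUnit a) : θ a = 0 := by
  obtain ⟨u, rfl⟩ := ha
  have h1 := h.map_mul u ↑(u⁻¹)
  rw [Units.mul_inv, h.map_one] at h1
  exact (add_eq_zero.1 h1.symm).1

theorem irreducible_iff {a : M} : Irreducible a ↔ IsMinZeroSum (θ a) := by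
  constructor
  · intro ha
    refine ⟨fun h0 => ha.not_isUnit (h.isUnit_of_eq_zero a h0), h.sum_eq_zero a, ?_⟩
    intro B hB hB0 hBs
    obtain ⟨C, hC⟩ := Multiset.le_iff_exists_add.1 hB
    obtain ⟨b, c, rfl, rfl, rfl⟩ := h.exists_mul a B C hC hBs
    rcases ha.isUnit_or_isUnit rfl with hu | hu
    · exact absurd (h.eq_zero_of_isUnit hu) hB0
    · rw [hC, h.eq_zero_of_isUnit hu, add_zero]
  · rintro ⟨h0, -, hmin⟩
    refine ⟨fun hu => h0 (h.eq_zero_of_isUnit hu), ?_⟩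
    rintro b c rfl
    by_cases hb : θ b = 0
    · exact Or.inl (h.isUnit_of_eq_zero b hb)
    · right
      have := hmin (θ b) (by rw [h.map_mul]; exact Multiset.le_add_right _ _) hb (h.sum_eq_zero b)
      rw [h.map_mul] at this
      exact h.isUnit_of_eq_zero c (by simpa using this)

theorem map_prod (s : Multiset M) : θ s.prod = (s.map θ).sum := by
  induction s using Multiset.induction_on with
  | empty => simpa using h.map_one
  | cons a s ih => simp [h.map_mul, ih]

theorem exists_factorization (z : Multiset (Multiset G)) (hz : ∀ A ∈ z, IsMinZeroSum A) (x : M)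
    (hx : ¬ IsUnit x) (hs : z.sum = θ x) :
    ∃ s : Multiset M, (∀ a ∈ s, Irreducible a) ∧ s.prod = x ∧ Multiset.card s = Multiset.card z := by
  induction z using Multiset.induction_on generalizing x with
  | empty => exact absurd (h.isUnit_of_eq_zero x (by simpa using hs.symm)) hx
  | cons A z ih =>
    have hA := hz A (by simp)
    by_cases hz0 : z = 0
    · subst hz0
      refine ⟨{x}, ?_, by simp, by simp⟩
      intro a ha
      rw [Multiset.mem_singleton.1 ha, h.irreducible_iff, ← hs]
      simpa using hA
    · obtain ⟨a, b, rfl, ha, hb⟩ := h.exists_mul x A z.sum (by simp [← hs]) hA.2.1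
      have hbu : ¬ IsUnit b := by
        intro hu
        obtain ⟨C, hC⟩ := Multiset.exists_mem_of_ne_zero hz0
        have h1 := Multiset.le_sum_of_mem hC
        rw [← hb, h.eq_zero_of_isUnit hu] at h1
        exact (hz C (by simp [hC])).1 (Multiset.le_zero.1 h1)
      obtain ⟨s, hs1, hs2, hs3⟩ := ih (fun C hC => hz C (by simp [hC])) b hbu hb.symm
      refine ⟨a ::ₘ s, ?_, by simp [hs2], by simp [hs3]⟩
      intro c hc
      rcases Multiset.mem_cons.1 hc with rfl | hc
      · rw [h.irreducible_iff, ha]; exact hA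
      · exact hs1 c hc

/-- Units must be excluded: a unit other than `1` has no factorization into atoms, while its image,
the empty sequence, has length `0`. -/
theorem lengthSet_eq {x : M} (hx : ¬ IsUnit x) : lengthSet x = zeroSumLengths (θ x) := by
  ext k
  constructor
  · rintro ⟨s, hs, rfl, rfl⟩
    refine ⟨s.map θ, ?_, (h.map_prod s).symm, by simp⟩
    intro A hA
    obtain ⟨a, ha, rfl⟩ := Multiset.mem_map.1 hA
    exact h.irreducible_iff.1 (hs a ha)
  · rintro ⟨z, hz, hs, rfl⟩
    exact h.exists_factorization z hz x hx hs

end IsTransfer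

theorem deltaSet_eq_empty_of_isUnit {x : M} (hx : IsUnit x) : deltaSet x = ∅ := by
  have key : ∀ k ∈ lengthSet x, k = 0 := by
    rintro k ⟨s, hs, rfl, rfl⟩
    rw [Multiset.card_eq_zero]
    by_contra h0
    obtain ⟨a, ha⟩ := Multiset.exists_mem_of_ne_zero h0
    exact (hs a ha).not_isUnit (isUnit_of_dvd_unit (Multiset.dvd_prod ha) hx)
  ext d
  simp only [Set.mem_empty_iff_false, iff_false]
  rintro ⟨hd, m, -, hm, -⟩
  have := key _ hm
  omega

end Transfer

/-! ### The transfer homomorphism of a Krull monoid -/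

namespace DivisorTheory

variable {M : Type*} [CancelCommMonoid M] {P : Type*} (φ : DivisorTheory M P)

/-- The sequence of the classes of the prime divisors of `a`. -/
def classSeq (a : M) : Multiset (Additive φ.ClassGroup) :=
  (φ.toHom a).toAdd.map fun p => Additive.ofMul (φ.toClass (Multiplicative.ofAdd {p}))

theorem sum_classes (α : Multiset P) :
    (α.map fun p => Additive.ofMul (φ.toClass (Multiplicative.ofAdd {p}))).sum =
      Additive.ofMul (φ.toClass (Multiplicative.ofAdd α)) := by
  induction α using Multiset.induction_on with
  | empty =>
    rw [ofAdd_zero, map_one]; rfl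
  | cons p α ih =>
    rw [Multiset.map_cons, Multiset.sum_cons, ih, ← Multiset.singleton_add, ofAdd_add, map_mul]
    rfl

theorem toClass_toHom (a : M) : φ.toClass (φ.toHom a) = 1 := by
  rw [← map_one φ.toClass]
  exact φ.classCon.eq.2 ⟨1, a, by simp⟩

theorem exists_toHom_eq {α : FreeAbelianMonoid P} (h : φ.toClass α = 1) :
    ∃ a, φ.toHom a = α := by
  rw [← map_one φ.toClass] at h
  obtain ⟨a, b, hab⟩ := φ.classCon.eq.1 h
  rw [mul_one] at hab
  obtain ⟨c, rfl⟩ := φ.dvd_of_map_dvd a b ⟨α, hab.symm⟩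
  rw [map_mul] at hab
  exact ⟨c, (mul_left_cancel hab).symm⟩

theorem isTransfer_classSeq : IsTransfer φ.classSeq where
  map_mul a b := by simp [classSeq]
  map_one := by simp [classSeq]
  isUnit_of_eq_zero a ha := by
    have h0 : φ.toHom a = 1 := by simpa [classSeq] using ha
    exact isUnit_of_dvd_one (φ.dvd_of_map_dvd a 1 (by rw [h0]; exact one_dvd _))
  sum_eq_zero a := by
    rw [classSeq, sum_classes, ofAdd_toAdd, toClass_toHom]; rfl
  exists_mul x B C hx hB := by
    obtain ⟨v, w, hvw, rfl, rfl⟩ := exists_add_of_map_eq_add _ _ _ _ hx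
    rw [sum_classes] at hB
    -- A divisor of trivial class is principal, so a zero-sum part of the class sequence lifts to a
    -- factor of `x`.
    obtain ⟨a, ha⟩ := φ.exists_toHom_eq (Additive.ofMul.injective hB)
    have hvw' : φ.toHom x = φ.toHom a * Multiplicative.ofAdd w := by
      rw [ha, ← ofAdd_add, ← hvw, ofAdd_toAdd]
    obtain ⟨b, rfl⟩ := φ.dvd_of_map_dvd a x ⟨_, hvw'⟩
    rw [map_mul] at hvw'
    refine ⟨a, b, rfl, ?_, ?_⟩
    · simp [classSeq, ha]
    · simp [classSeq, mul_left_cancel hvw']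

end DivisorTheory

/-! ### Minimal zero-sum sequences over a finite abelian group -/

variable {G : Type*} [AddCommGroup G]

open Multiset

theorem add_mem_zeroSumLengths {B C : Multiset G} {j k : ℕ} (hj : j ∈ zeroSumLengths B)
    (hk : k ∈ zeroSumLengths C) : j + k ∈ zeroSumLengths (B + C) := by
  obtain ⟨y, hy, rfl, rfl⟩ := hj
  obtain ⟨z, hz, rfl, rfl⟩ := hk
  refine ⟨y + z, ?_, by simp, by simp⟩
  intro A hA
  rcases mem_add.1 hA with h | h
  exacts [hy A h, hz A h]

theorem card_mem_zeroSumLengths {z : Multiset (Multiset G)} (hz : ∀ A ∈ z, IsMinZeroSum A) :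
    card z ∈ zeroSumLengths z.sum :=
  ⟨z, hz, rfl, rfl⟩

theorem IsMinZeroSum.one_mem_zeroSumLengths {A : Multiset G} (hA : IsMinZeroSum A) :
    1 ∈ zeroSumLengths A :=
  ⟨{A}, by simpa using hA, by simp, by simp⟩

theorem exists_sum_eq_of_sum_eq_zero (B : Multiset G) (hB : B.sum = 0) :
    ∃ z : Multiset (Multiset G), (∀ A ∈ z, IsMinZeroSum A) ∧ z.sum = B := by
  induction B using Multiset.strongInductionOn with
  | ih B ih =>
    by_cases h0 : B = 0
    · exact ⟨0, by simp, by simp [h0]⟩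
    by_cases hmin : IsMinZeroSum B
    · exact ⟨{B}, by simpa using hmin, by simp⟩
    simp only [IsMinZeroSum, not_and, not_forall] at hmin
    obtain ⟨C, hCB, hC0, hCs, hne⟩ := hmin h0 hB
    obtain ⟨D, rfl⟩ := Multiset.le_iff_exists_add.1 hCB
    have hDs : D.sum = 0 := by simpa [hCs] using hB
    have hD0 : D ≠ 0 := by rintro rfl; simp at hne
    have h1 : C < C + D := lt_of_le_of_ne hCB hne
    have h2 : D < C + D := lt_of_le_of_ne (Multiset.le_add_left _ _) (by simpa using hC0)
    obtain ⟨y, hy, rfl⟩ := ih C h1 hCs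
    obtain ⟨z, hz, rfl⟩ := ih D h2 hDs
    refine ⟨y + z, ?_, by simp⟩
    intro A hA
    rcases mem_add.1 hA with h | h
    exacts [hy A h, hz A h]

theorem le_of_le_add_replicate {α : Type*} {F A : Multiset α} {g : α} {k : ℕ} (h : F ≤ A + replicate k g)
    (hg : g ∉ F) : F ≤ A := by
  classical
  rw [Multiset.le_iff_count] at h ⊢
  intro x
  have := h x
  by_cases hx : x = g
  · subst hx
    rw [Multiset.count_eq_zero_of_notMem hg]; exact Nat.zero_le _
  · rwa [count_add, count_replicate, if_neg (Ne.symm hx), add_zero] at this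

namespace IsMinZeroSum

variable {A : Multiset G}

theorem eq_of_le (hA : IsMinZeroSum A) {B : Multiset G} (h : B ≤ A) (h0 : B ≠ 0)
    (hs : B.sum = 0) : B = A := hA.2.2 B h h0 hs

theorem eq_singleton_zero (hA : IsMinZeroSum A) (h : 0 ∈ A) : A = {0} :=
  (hA.eq_of_le (B := {0}) (by simpa using h) (by simp) (by simp)).symm

theorem pair (hA : IsMinZeroSum A) {u : G} (hu : u ≠ -u) (h1 : u ∈ A) (h2 : -u ∈ A) :
    A = {u, -u} := by
  refine (hA.eq_of_le ?_ (by simp) (by simp)).symm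
  rw [Multiset.le_iff_subset (by simpa using hu)]
  intro x hx
  simp only [insert_eq_cons, mem_cons, mem_singleton] at hx
  rcases hx with rfl | rfl <;> assumption

/-- A nonempty part of a proper part of a minimal zero-sum sequence has nonzero sum. -/
theorem sum_ne_zero (hA : IsMinZeroSum A) {A' B : Multiset G} (hlt : A' < A)
    (hB : B ≤ A') (h0 : B ≠ 0) : B.sum ≠ 0 :=
  fun hs => (hB.trans_lt hlt).ne (hA.eq_of_le (hB.trans hlt.le) h0 hs)

/-- Otherwise `F` would lie in the proper part `A'` of `A`, which has no nonempty zero-sum part.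
Thus the copies of `g` control the number of atoms. -/
theorem mem_of_le_add_replicate (hA : IsMinZeroSum A) {g : G} {A' F : Multiset G} {k : ℕ}
    (hlt : A' < A) (hF : IsMinZeroSum F) (hFA : F ≤ A' + replicate k g) : g ∈ F := by
  by_contra hg
  exact hA.sum_ne_zero hlt (le_of_le_add_replicate hFA hg) hF.1 hF.2.1

theorem of_pair {g : G} (hg : g ≠ 0) : IsMinZeroSum ({g, -g} : Multiset G) := by
  refine ⟨by simp, by simp, ?_⟩
  intro B hB h0 hs
  by_contra hne
  have h1 := Multiset.card_lt_card (lt_of_le_of_ne hB hne)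
  have h2 : 0 < card B := Multiset.card_pos.2 h0
  have h3 : card B = 1 := by simp at h1; omega
  obtain ⟨x, rfl⟩ := Multiset.card_eq_one.1 h3
  have hx : x ∈ ({g, -g} : Multiset G) := by simpa using hB
  simp at hs hx
  subst hs
  rcases hx with h | h
  · exact hg h.symm
  · exact hg (by simpa using h.symm)

theorem of_replicate {g : G} (hg : 0 < addOrderOf g) :
    IsMinZeroSum (replicate (addOrderOf g) g) := by
  refine ⟨?_, by simp [addOrderOf_nsmul_eq_zero], ?_⟩
  · intro h
    have := congrArg card h
    simp only [card_replicate, card_zero] at this; omega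
  · intro B hB h0 hs
    obtain ⟨m, hm, rfl⟩ := le_replicate_iff.1 hB
    rw [sum_replicate] at hs
    have := addOrderOf_dvd_of_nsmul_eq_zero hs
    rcases Nat.eq_zero_or_pos m with rfl | hm0
    · simp at h0
    · rw [Nat.le_antisymm hm (Nat.le_of_dvd hm0 this)]

theorem of_cons_replicate {g : G} {a : ℕ} (ha : a < addOrderOf g) :
    IsMinZeroSum ((a • g) ::ₘ replicate a (-g)) := by
  classical
  refine ⟨by simp, by simp, ?_⟩
  intro B hB h0 hs
  by_cases hm : a • g ∈ B
  · obtain ⟨C, rfl⟩ := Multiset.exists_cons_of_mem hm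
    obtain ⟨m, hma, rfl⟩ := le_replicate_iff.1 ((cons_le_cons_iff _).1 hB)
    have h1 : (a - m) • g = 0 := by
      rw [sub_nsmul _ hma]
      simpa using hs
    have := Nat.eq_zero_of_dvd_of_lt (addOrderOf_dvd_of_nsmul_eq_zero h1) (by omega)
    rw [show m = a by omega]
  · obtain ⟨m, hm', rfl⟩ := le_replicate_iff.1 ((le_cons_of_notMem hm).1 hB)
    have h1 : m • g = 0 := by simpa using hs
    have := Nat.eq_zero_of_dvd_of_lt (addOrderOf_dvd_of_nsmul_eq_zero h1) (by omega)
    subst this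
    simp at h0

/-- Two equal partial sums would enclose a zero-sum block that is nonempty and proper. Hence an atom
has at most `|G|` terms. -/
theorem injOn_sum_take {l : List G} (hl : IsMinZeroSum (l : Multiset G)) :
    Set.InjOn (fun i => (l.take i).sum) (Set.Icc 1 l.length) := by
  have key : ∀ i j, 1 ≤ i → i < j → j ≤ l.length → (l.take i).sum ≠ (l.take j).sum := by
    intro i j hi hij hj h
    have h1 : l.take j = l.take i ++ (l.take j).drop i := by
      conv_lhs => rw [← List.take_append_drop i (l.take j)]
      rw [List.take_take, min_eq_left hij.le]
    have h2 : ((l.take j).drop i).sum = 0 := by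
      rw [h1, List.sum_append] at h
      simpa using h
    have hlen : ((l.take j).drop i).length = j - i := by
      rw [List.length_drop, List.length_take, min_eq_left hj]
    have h3 := hl.eq_of_le (B := ((l.take j).drop i : List G))
      (((List.drop_sublist _ _).trans (List.take_sublist _ _)).subperm)
      (by rw [Ne, ← Multiset.card_eq_zero, coe_card, hlen]; omega) (by simpa using h2)
    have h4 := congrArg card h3
    rw [coe_card, coe_card, hlen] at h4
    omega
  intro i hi j hj h
  rcases lt_trichotomy i j with hij | hij | hij
  · exact absurd h (key i j hi.1 hij hj.2)
  · exact hij
  · exact absurd h.symm (key j i hj.1 hij hi.2)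

theorem card_le [Finite G] (hA : IsMinZeroSum A) : card A ≤ Nat.card G := by
  classical
  obtain ⟨l, rfl⟩ := Quot.exists_rep A
  have := Fintype.ofFinite G
  have h := hA.injOn_sum_take
  rw [← Finset.coe_Icc] at h
  have h1 := Finset.card_image_of_injOn h
  rw [Nat.card_eq_fintype_card]
  have h2 := Finset.card_le_univ
    ((Finset.Icc 1 l.length).image fun i => (l.take i).sum)
  rw [h1] at h2
  simpa using h2

/-- Any two terms `u`, `v` are equal: the orderings `u, v, …` and `v, u, …` share the partial sums
of length at least `2`. These are `|G| - 1` distinct elements that miss both `u` and `v`, so both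
are the one remaining element. -/
theorem eq_replicate_of_card_eq [Finite G] (hA : IsMinZeroSum A) (hc : card A = Nat.card G) :
    ∃ g : G, A = replicate (Nat.card G) g ∧ addOrderOf g = Nat.card G := by
  classical
  have := Fintype.ofFinite G
  have key : ∀ (u v : G) (B : Multiset G), A = u ::ₘ v ::ₘ B → u = v := by
    intro u v B hAB
    obtain ⟨l, rfl⟩ := Quot.exists_rep B
    have aux : ∀ u v : G, A = u ::ₘ v ::ₘ (l : Multiset G) →
        u ∉ (Finset.Icc 2 (l.length + 2)).image fun i => u + (v + (l.take (i - 2)).sum) := by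
      intro u v huv hu
      have hl : IsMinZeroSum ((u :: v :: l : List G) : Multiset G) := by
        rw [huv] at hA; simpa using hA
      obtain ⟨i, hi, h⟩ := Finset.mem_image.1 hu
      rw [Finset.mem_Icc] at hi
      have := hl.injOn_sum_take (x₁ := i) (x₂ := 1) ⟨by omega, by simpa using hi.2⟩ (by simp) (by
        obtain ⟨j, rfl⟩ := Nat.exists_eq_add_of_le hi.1
        simp only [Nat.add_sub_cancel_left] at h
        simpa [Nat.add_comm 2 j] using h)
      omega
    have hl : IsMinZeroSum ((u :: v :: l : List G) : Multiset G) := by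
      rw [hAB] at hA; simpa using hA
    have hu := aux u v hAB
    have hv := aux v u (by rw [hAB]; exact cons_swap _ _ _)
    simp only [add_left_comm v u] at hv
    set S := (Finset.Icc 2 (l.length + 2)).image fun i => u + (v + (l.take (i - 2)).sum)
    have hS : S.card = l.length + 1 := by
      rw [Finset.card_image_of_injOn]
      · simp
      · intro i hi j hj h
        simp only [Finset.coe_Icc, Set.mem_Icc] at hi hj
        refine hl.injOn_sum_take (x₁ := i) (x₂ := j) ⟨by omega, by simpa using hi.2⟩
          ⟨by omega, by simpa using hj.2⟩ ?_
        obtain ⟨i, rfl⟩ := Nat.exists_eq_add_of_le hi.1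
        obtain ⟨j, rfl⟩ := Nat.exists_eq_add_of_le hj.1
        simp only [Nat.add_sub_cancel_left] at h
        simpa [Nat.add_comm 2] using h
    have hcG : Fintype.card G = l.length + 2 := by
      rw [← Nat.card_eq_fintype_card, ← hc, hAB]
      simp
    have hcompl : Sᶜ.card = 1 := by
      rw [Finset.card_compl, hS, hcG]; omega
    obtain ⟨w, hw⟩ := Finset.card_eq_one.1 hcompl
    have h1 : u ∈ Sᶜ := by simpa using hu
    have h2 : v ∈ Sᶜ := by simpa using hv
    rw [hw, Finset.mem_singleton] at h1 h2
    rw [h1, h2]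
  obtain ⟨g, hg⟩ := Multiset.exists_mem_of_ne_zero hA.1
  obtain ⟨B, hB⟩ := Multiset.exists_cons_of_mem hg
  have hrep : A = replicate (Nat.card G) g := by
    rw [Multiset.eq_replicate]
    refine ⟨hc, fun b hb => ?_⟩
    rw [hB] at hb
    rcases mem_cons.1 hb with h | h
    · exact h
    · obtain ⟨C, rfl⟩ := Multiset.exists_cons_of_mem h
      exact (key g b C hB).symm
  refine ⟨g, hrep, ?_⟩
  have hpos := addOrderOf_pos g
  have h1 : replicate (addOrderOf g) g = A := by
    apply hA.eq_of_le
    · rw [hrep]; exact replicate_le_replicate _ |>.2 addOrderOf_le_card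
    · exact (of_replicate hpos).1
    · exact (of_replicate hpos).2.1
  rw [← hc, ← h1, card_replicate]

end IsMinZeroSum

/-! ### Atoms next to `gⁿ(-g)ⁿ` have all terms in `{0, g, -g}` -/

theorem mul_card_le_card_sum {α : Type*} {z : Multiset (Multiset α)} {c : ℕ}
    (h : ∀ F ∈ z, c ≤ card F) : c * card z ≤ card z.sum := by
  induction z using Multiset.induction_on with
  | empty => simp
  | cons F z ih =>
    have h1 := h F (by simp)
    have h2 := ih fun F hF => h F (by simp [hF])
    simp only [card_cons, sum_cons, card_add, mul_add, mul_one]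
    omega

theorem mul_card_le_count_sum {α : Type*} [DecidableEq α] {z : Multiset (Multiset α)} {g : α}
    (h : ∀ F ∈ z, g ∈ F) : card z ≤ z.sum.count g := by
  induction z using Multiset.induction_on with
  | empty => simp
  | cons F z ih =>
    have h1 := Multiset.one_le_count_iff_mem.2 (h F (by simp))
    have h2 := ih fun F hF => h F (by simp [hF])
    simp only [card_cons, sum_cons, count_add]
    omega

theorem sum_replicate_pair {α : Type*} (m : ℕ) (x y : α) :
    (replicate m ({x, y} : Multiset α)).sum = replicate m x + replicate m y := by
  rw [sum_replicate, ← Multiset.nsmul_singleton, ← Multiset.nsmul_singleton, ← nsmul_add]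
  rfl

theorem mem_zeroSumLengths_replicate_pair {g : G} (hg : g ≠ 0) (m : ℕ) :
    m ∈ zeroSumLengths (replicate m g + replicate m (-g)) :=
  ⟨replicate m {g, -g}, fun A hA => by rw [eq_of_mem_replicate hA]; exact .of_pair hg,
    sum_replicate_pair _ _ _, by simp⟩

theorem exists_nsmul_eq [Finite G] {g : G} (hg : addOrderOf g = Nat.card G) (x : G) :
    ∃ a < Nat.card G, a • g = x := by
  classical
  have htop : AddSubgroup.zmultiples g = ⊤ := by
    apply AddSubgroup.eq_top_of_card_eq
    rw [Nat.card_zmultiples, hg]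
  have hx : x ∈ AddSubgroup.zmultiples g := by rw [htop]; trivial
  rw [← mem_multiples_iff_mem_zmultiples, mem_multiples_iff_mem_range_addOrderOf, hg] at hx
  obtain ⟨a, ha, h⟩ := Finset.mem_image.1 hx
  exact ⟨a, Finset.mem_range.1 ha, h⟩

theorem ne_zero_of_addOrderOf {g : G} {n : ℕ} (hn : 3 ≤ n) (hg : addOrderOf g = n) : g ≠ 0 := by
  rintro rfl; simp at hg; omega

theorem ne_neg_of_addOrderOf {g : G} {n : ℕ} (hn : 3 ≤ n) (hg : addOrderOf g = n) : g ≠ -g := by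
  intro h
  have h2 : 2 • g = 0 := by rw [two_nsmul]; nth_rewrite 1 [h]; simp
  have := Nat.le_of_dvd (by norm_num) (addOrderOf_dvd_of_nsmul_eq_zero h2)
  omega

/-- If exchanging parts of `A` against `gⁿ(-g)ⁿ` gives no length strictly between `3` and `n + 1`,
then completing the complement of a term `a • g` of `A` by `a` copies of `g` takes at least `a`
minimal zero-sum sequences. -/
theorem le_of_mem_zeroSumLengths {g : G} {n : ℕ} (hn : 3 ≤ n) (hg : addOrderOf g = n)
    {A' : Multiset G} {a : ℕ} (ha : 2 ≤ a) (han : a + 2 ≤ n)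
    (h : ∀ t ∈ zeroSumLengths ((a • g ::ₘ A') + (replicate n g + replicate n (-g))),
      t ≤ 3 ∨ n + 1 ≤ t) {t : ℕ} (ht : t ∈ zeroSumLengths (A' + replicate a g)) : a ≤ t := by
  have h1 := (IsMinZeroSum.of_cons_replicate (g := g) (a := a) (by omega)).one_mem_zeroSumLengths
  have h2 := mem_zeroSumLengths_replicate_pair (ne_zero_of_addOrderOf hn hg) (n - a)
  have h3 := add_mem_zeroSumLengths (add_mem_zeroSumLengths ht h1) h2
  have h4 : A' + replicate a g + (a • g ::ₘ replicate a (-g)) +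
      (replicate (n - a) g + replicate (n - a) (-g)) =
      (a • g ::ₘ A') + (replicate n g + replicate n (-g)) := by
    obtain ⟨b, rfl⟩ := Nat.exists_eq_add_of_le (show a ≤ n by omega)
    rw [Nat.add_sub_cancel_left, replicate_add, replicate_add, ← singleton_add, ← singleton_add]
    abel
  rw [h4] at h3
  -- The length built above is `t + 1 + (n - a)`. With `t ≥ 1` and `n - a ≥ 2` it exceeds `3`, so it
  -- is at least `n + 1`.
  have h5 : t ≠ 0 := by
    rintro rfl
    obtain ⟨z, -, hz, hc⟩ := ht
    rw [Multiset.card_eq_zero.1 hc] at hz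
    have := congrArg card hz
    simp at this
    omega
  have := h _ h3
  omega

theorem IsMinZeroSum.two_mul_le_card {g : G} {n : ℕ} (hn : 3 ≤ n) (hg : addOrderOf g = n)
    {A A' : Multiset G} (hA : IsMinZeroSum A) {a : ℕ} (hAA : A = a • g ::ₘ A') (ha : 2 ≤ a)
    (han : a + 2 ≤ n)
    (h : ∀ t ∈ zeroSumLengths (A + (replicate n g + replicate n (-g))), t ≤ 3 ∨ n + 1 ≤ t)
    (hgA : -g ∉ A) : 2 * a ≤ card A' := by
  obtain ⟨z, hz, hzs⟩ := exists_sum_eq_of_sum_eq_zero (A' + replicate a g) (by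
    have := hA.2.1
    rw [hAA, sum_cons] at this
    rw [sum_add, sum_replicate, add_comm, this])
  have h1 := le_of_mem_zeroSumLengths hn hg ha han (by rwa [← hAA])
    (hzs ▸ card_mem_zeroSumLengths hz)
  -- Every atom of `A' gᵃ` contains `g`; as `g ≠ 0` and `-g` does not occur, it has at least three
  -- terms. At least `a` such atoms need `3a ≤ |A'| + a`.
  have h3 : ∀ F ∈ z, 3 ≤ card F := by
    intro F hF
    have hle : F ≤ A' + replicate a g := hzs ▸ Multiset.le_sum_of_mem hF
    have hgF := hA.mem_of_le_add_replicate (hAA ▸ lt_cons_self _ _) (hz F hF) hle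
    obtain ⟨C, rfl⟩ := Multiset.exists_cons_of_mem hgF
    have hs := (hz _ hF).2.1
    by_contra hlt
    rw [card_cons] at hlt
    rcases (show card C = 0 ∨ card C = 1 by omega) with hC | hC
    · rw [Multiset.card_eq_zero.1 hC] at hs
      exact ne_zero_of_addOrderOf hn hg (by simpa using hs)
    · obtain ⟨u, rfl⟩ := Multiset.card_eq_one.1 hC
      have hu : u = -g := by
        rw [sum_cons, sum_singleton] at hs
        exact (neg_eq_of_add_eq_zero_right hs).symm
      have hmem : u ∈ A' + replicate a g := Multiset.mem_of_le hle (by simp)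
      rcases mem_add.1 hmem with h' | h'
      · exact hgA (by rw [hAA, ← hu]; exact mem_cons_of_mem h')
      · exact ne_neg_of_addOrderOf hn hg (by rw [← hu, eq_of_mem_replicate h'])
  have h4 := mul_card_le_card_sum h3
  rw [hzs, card_add, card_replicate] at h4
  omega

theorem nsmul_eq_nsmul_neg {g : G} {n a : ℕ} (hg : addOrderOf g = n) (ha : a ≤ n) :
    a • g = (n - a) • (-g) := by
  rw [neg_nsmul, sub_nsmul _ ha, ← hg, addOrderOf_nsmul_eq_zero]
  simp

/-- The case `-g ∉ A` of `IsMinZeroSum.mem_eq_of_lengths`. -/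
theorem IsMinZeroSum.false_of_mem [Finite G] {g : G} {n : ℕ} (hn : 3 ≤ n) (hcard : Nat.card G = n)
    (hg : addOrderOf g = n) {A A' : Multiset G} (hA : IsMinZeroSum A) {a : ℕ}
    (hAA : A = a • g ::ₘ A') (ha : 2 ≤ a) (han : a + 2 ≤ n)
    (h : ∀ t ∈ zeroSumLengths (A + (replicate n g + replicate n (-g))), t ≤ 3 ∨ n + 1 ≤ t)
    (hgA : -g ∉ A) : False := by
  classical
  have hAc := hA.card_le
  have hA'c : card A' + 1 ≤ n := by
    rw [hAA, card_cons, hcard] at hAc; exact hAc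
  have hsum : a • g + A'.sum = 0 := by
    have := hA.2.1
    rwa [hAA, sum_cons] at this
  have ha2 := hA.two_mul_le_card hn hg hAA ha han h hgA
  by_cases hall : ∀ b ∈ A', b = g
  · have hrep := Multiset.eq_replicate_card.2 hall
    have h1 : (a + card A') • g = 0 := by
      rw [hrep, sum_replicate] at hsum
      rw [add_nsmul, hsum]
    obtain ⟨c, hc⟩ := addOrderOf_dvd_of_nsmul_eq_zero h1
    rw [hg] at hc
    have hc1 : c = 1 := by
      have : n * c < n * 2 := by omega
      have := Nat.lt_of_mul_lt_mul_left this
      have : c ≠ 0 := by rintro rfl; omega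
      omega
    subst hc1
    -- Here `A' gᵃ = gⁿ` is a single atom, but it should have no length below `a ≥ 2`.
    have h2 := IsMinZeroSum.of_replicate (g := g) (by omega)
    have h3 : replicate (addOrderOf g) g = A' + replicate a g := by
      rw [hg, show n = card A' + a by omega, replicate_add, ← hrep]
    have h4 := le_of_mem_zeroSumLengths hn hg ha han (by rwa [← hAA])
      (h3 ▸ h2.one_mem_zeroSumLengths)
    omega
  · push Not at hall
    obtain ⟨x, hx, hxg⟩ := hall
    obtain ⟨b, hb, rfl⟩ := exists_nsmul_eq (hg.trans hcard.symm) x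
    rw [hcard] at hb
    have hmA : b • g ∈ A := by rw [hAA]; exact mem_cons_of_mem hx
    have hb0 : b ≠ 0 := by
      rintro rfl
      rw [zero_nsmul] at hmA
      have := congrArg card (hA.eq_singleton_zero hmA)
      rw [hAA, card_cons, card_singleton] at this
      omega
    have hb1 : b ≠ 1 := by rintro rfl; simp at hxg
    have hbn : b ≠ n - 1 := by
      intro hbn
      apply hgA
      rw [nsmul_eq_nsmul_neg hg hb.le, show n - b = 1 by omega, one_nsmul] at hmA
      exact hmA
    obtain ⟨A'', rfl⟩ := Multiset.exists_cons_of_mem hx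
    have hb2 := hA.two_mul_le_card hn hg (hAA.trans (cons_swap _ _ _)) (by omega : 2 ≤ b)
      (by omega) h hgA
    rw [card_cons] at hb2 ha2 hA'c
    -- The bounds `2a, 2b ≤ |A''| + 1 ≤ n - 1` give `a + b < n`, so `A''` can be completed by `n - a
    -- - b` copies of `-g`. Each atom uses at least one of them.
    obtain ⟨z, hz, hzs⟩ := exists_sum_eq_of_sum_eq_zero (A'' + replicate (n - a - b) (-g)) (by
      rw [sum_add, sum_replicate, show n - a - b = n - (a + b) by omega,
        ← nsmul_eq_nsmul_neg hg (by omega), add_nsmul, add_comm, add_assoc]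
      rwa [sum_cons] at hsum)
    have hzc : card z ≤ n - a - b := by
      have h1 : ∀ F ∈ z, -g ∈ F := by
        intro F hF
        exact hA.mem_of_le_add_replicate
          (hAA ▸ (lt_cons_self _ _).trans (lt_cons_self _ _)) (hz F hF)
          (hzs ▸ Multiset.le_sum_of_mem hF)
      have h2 := mul_card_le_count_sum h1
      rw [hzs, count_add, count_replicate_self, count_eq_zero_of_notMem] at h2
      · omega
      · intro hm
        exact hgA (by rw [hAA]; exact mem_cons_of_mem (mem_cons_of_mem hm))
    have h1 := (IsMinZeroSum.of_cons_replicate (g := g) (a := b) (by omega)).one_mem_zeroSumLengths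
    have h2 := add_mem_zeroSumLengths h1 (card_mem_zeroSumLengths hz)
    have h3 : (b • g ::ₘ replicate b (-g)) + z.sum = (b • g ::ₘ A'') + replicate (n - a) (-g) := by
      rw [hzs, show n - a = b + (n - a - b) by omega, replicate_add, ← singleton_add,
        ← singleton_add, show b + (n - a - b) - b = n - a - b by omega]
      abel
    rw [h3] at h2
    -- With `-g` as generator, `a • g` is `(n - a) • (-g)`, so the length just found should be at
    -- least `n - a`. It is at most `1 + (n - a - b)`, which is smaller because `b ≥ 2`.
    have h4 := le_of_mem_zeroSumLengths (g := -g) hn (by rwa [addOrderOf_neg])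
      (A' := b • g ::ₘ A'') (a := n - a) (by omega) (by omega) (by
        rw [← nsmul_eq_nsmul_neg hg (by omega), ← hAA, neg_neg, add_comm (replicate n (-g))]
        exact h) h2
    omega

theorem IsMinZeroSum.mem_eq_of_lengths [Finite G] {g : G} {n : ℕ} (hn : 3 ≤ n)
    (hcard : Nat.card G = n) (hg : addOrderOf g = n) {A : Multiset G} (hA : IsMinZeroSum A)
    (h : ∀ t ∈ zeroSumLengths (A + (replicate n g + replicate n (-g))), t ≤ 3 ∨ n + 1 ≤ t)
    {x : G} (hx : x ∈ A) : x = 0 ∨ x = g ∨ x = -g := by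
  by_contra! hne
  obtain ⟨a, ha, rfl⟩ := exists_nsmul_eq (hg.trans hcard.symm) x
  rw [hcard] at ha
  have hneg := nsmul_eq_nsmul_neg hg ha.le
  have ha0 : a ≠ 0 := by rintro rfl; simp at hne
  have ha1 : a ≠ 1 := by rintro rfl; simp at hne
  have han : a ≠ n - 1 := by
    intro han
    rw [hneg, show n - a = 1 by omega, one_nsmul] at hne
    exact hne.2.2 rfl
  obtain ⟨A', hAA⟩ := Multiset.exists_cons_of_mem hx
  have hg' : addOrderOf (-g) = n := by rwa [addOrderOf_neg]
  have h' : ∀ t ∈ zeroSumLengths (A + (replicate n (-g) + replicate n (- -g))),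
      t ≤ 3 ∨ n + 1 ≤ t := by
    rw [neg_neg, add_comm (replicate n (-g))]; exact h
  -- If both `g` and `-g` occur, then `A` is `{g, -g}`; if only `-g` does, the two generators trade
  -- roles.
  by_cases h1 : -g ∈ A
  · by_cases h2 : g ∈ A
    · rw [hA.pair (ne_neg_of_addOrderOf hn hg) h2 h1] at hx
      simp only [insert_eq_cons, mem_cons, mem_singleton] at hx
      tauto
    · exact hA.false_of_mem hn hcard hg' (hAA.trans (by rw [hneg])) (by omega) (by omega) h'
        (by rwa [neg_neg])
  · exact hA.false_of_mem hn hcard hg hAA (by omega) (by omega) h h1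

/-! ### Exchanging atoms across a gap -/

/-- Greedy choice: a member of `s` is kept only if it meets the part of `U` not yet covered, so each
one kept covers at least one further term. -/
theorem exists_le_le_sum {α : Type*} (s : Multiset (Multiset α)) (U : Multiset α)
    (h : U ≤ s.sum) : ∃ t ≤ s, U ≤ t.sum ∧ card t ≤ card U ∧ ∀ V ∈ t, ∃ x ∈ V, x ∈ U := by
  classical
  induction s using Multiset.induction_on generalizing U with
  | empty => exact ⟨0, le_rfl, h, by simp, by simp⟩
  | cons V s ih =>
    rw [sum_cons] at h
    obtain ⟨t, hts, hUt, hc, hV⟩ := ih (U - V) (by rwa [Multiset.sub_le_iff_le_add'])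
    have hle : U - V ≤ U := Multiset.sub_le_self _ _
    by_cases hUV : ∃ x ∈ V, x ∈ U
    · refine ⟨V ::ₘ t, by simpa using hts, ?_, ?_, ?_⟩
      · rw [sum_cons, ← Multiset.sub_le_iff_le_add']; exact hUt
      · obtain ⟨x, hxV, hxU⟩ := hUV
        have hlt : U - V < U := by
          refine lt_of_le_of_ne hle fun h => ?_
          have h1 := congrArg (count x) h
          rw [count_sub] at h1
          have h2 := Multiset.one_le_count_iff_mem.2 hxV
          have h3 := Multiset.one_le_count_iff_mem.2 hxU
          omega
        have := Multiset.card_lt_card hlt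
        rw [card_cons]; omega
      · intro W hW
        rcases mem_cons.1 hW with rfl | hW
        · exact hUV
        · obtain ⟨x, hx, hxU⟩ := hV W hW
          exact ⟨x, hx, Multiset.mem_of_le hle hxU⟩
    · have heq : U - V = U := by
        ext x
        rw [count_sub]
        by_cases hx : x ∈ U
        · rw [count_eq_zero_of_notMem (a := x) (s := V) fun hxV => hUV ⟨x, hxV, hx⟩, Nat.sub_zero]
        · rw [count_eq_zero_of_notMem hx, Nat.zero_sub]
      rw [heq] at hUt hc hV
      exact ⟨t, hts.trans (le_cons_self _ _), hUt, hc, hV⟩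

theorem forall_card_eq_of_card_sum_le {α : Type*} {z : Multiset (Multiset α)} {c : ℕ}
    (h : ∀ F ∈ z, c ≤ card F) (hz : card z.sum ≤ c * card z) : ∀ F ∈ z, card F = c := by
  intro F hF
  obtain ⟨z, rfl⟩ := Multiset.exists_cons_of_mem hF
  have h1 := h F hF
  have h2 := mul_card_le_card_sum fun E hE => h E (mem_cons_of_mem hE)
  simp only [card_cons, sum_cons, card_add, mul_add, mul_one] at hz
  omega

theorem sum_sum_eq_zero {t : Multiset (Multiset G)} (ht : ∀ V ∈ t, V.sum = 0) : t.sum.sum = 0 := by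
  induction t using Multiset.induction_on with
  | empty => simp
  | cons V t ih =>
    rw [sum_cons, sum_add, ht V (mem_cons_self _ _), ih fun W hW => ht W (mem_cons_of_mem hW),
      add_zero]

/-- A minimal zero-sum sequence dividing a product of minimal zero-sum sequences can only be the
whole product if there is one factor. -/
theorem IsMinZeroSum.card_eq_one_of_sum_eq {U : Multiset G} (hU : IsMinZeroSum U)
    {t : Multiset (Multiset G)} (ht : ∀ V ∈ t, IsMinZeroSum V) (hs : t.sum = U) : card t = 1 := by
  have h0 : t ≠ 0 := by rintro rfl; exact hU.1 (by simpa using hs.symm)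
  obtain ⟨V, hV⟩ := Multiset.exists_mem_of_ne_zero h0
  have hVU := hU.eq_of_le (hs ▸ Multiset.le_sum_of_mem hV) (ht V hV).1 (ht V hV).2.1
  obtain ⟨t, rfl⟩ := Multiset.exists_cons_of_mem hV
  have ht0 : t = 0 := by
    by_contra ht0
    obtain ⟨W, hW⟩ := Multiset.exists_mem_of_ne_zero ht0
    rw [sum_cons, hVU] at hs
    have h1 : t.sum = 0 := by simpa using hs
    have h2 := Multiset.le_sum_of_mem hW
    rw [h1] at h2
    exact (ht W (mem_cons_of_mem hW)).1 (Multiset.le_zero.1 h2)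
  simp [ht0]

/-- If `n = |G|` minimal zero-sum sequences are exchanged against two, one of which has length `n`
and meets all of the `n`, then this is the exchange of `(g(-g))ⁿ` against `gⁿ(-g)ⁿ`. -/
theorem exists_generator_of_exchange [Finite G] {n : ℕ} (hn : 3 ≤ n) (hcard : Nat.card G = n)
    {U W : Multiset G} (hU : IsMinZeroSum U) (hW : IsMinZeroSum W) (hUn : card U = n)
    {t : Multiset (Multiset G)} (ht : ∀ V ∈ t, IsMinZeroSum V) (htc : card t = n)
    (hmeet : ∀ V ∈ t, ∃ x ∈ V, x ∈ U) (hs : t.sum = U + W) :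
    ∃ g : G, addOrderOf g = n ∧ t.sum = replicate n g + replicate n (-g) := by
  obtain ⟨g, hUg, hg⟩ := hU.eq_replicate_of_card_eq (hUn.trans hcard.symm)
  rw [hcard] at hUg hg
  have hg0 := ne_zero_of_addOrderOf hn hg
  have hgV : ∀ V ∈ t, g ∈ V := by
    intro V hV
    obtain ⟨x, hx, hxU⟩ := hmeet V hV
    rw [hUg] at hxU
    rwa [← eq_of_mem_replicate hxU]
  have h2 : ∀ V ∈ t, 2 ≤ card V := by
    intro V hV
    have h1 := Multiset.card_pos.2 (ht V hV).1
    by_contra hlt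
    obtain ⟨x, rfl⟩ := Multiset.card_eq_one.1 (show card V = 1 by omega)
    have hx := hgV _ hV
    have h3 := (ht _ hV).2.1
    rw [mem_singleton] at hx
    rw [sum_singleton, ← hx] at h3
    exact hg0 h3
  have hWn := hW.card_le
  -- The `n` atoms of `t` have at least two terms each and at most `|U| + |W| ≤ 2n` in total, so
  -- each has exactly two.
  have h3 := forall_card_eq_of_card_sum_le h2 (by rw [hs, card_add]; omega)
  have h4 : ∀ V ∈ t, V = {g, -g} := by
    intro V hV
    obtain ⟨C, rfl⟩ := Multiset.exists_cons_of_mem (hgV V hV)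
    have h5 := h3 _ hV
    rw [card_cons] at h5
    obtain ⟨u, rfl⟩ := Multiset.card_eq_one.1 (show card C = 1 by omega)
    have h6 := (ht _ hV).2.1
    rw [sum_cons, sum_singleton] at h6
    rw [← neg_eq_of_add_eq_zero_right h6]
    rfl
  refine ⟨g, hg, ?_⟩
  rw [Multiset.eq_replicate.2 ⟨htc, h4⟩, sum_replicate_pair]

/-- Two lengths of a zero-sum sequence at distance at least `n - 2` without a length in between
come from an exchange of `(g(-g))ⁿ` against `gⁿ(-g)ⁿ`, where `g` has order `n = |G|`. -/
theorem exists_generator_of_gap [Finite G] {n : ℕ} (hn : 3 ≤ n) (hcard : Nat.card G = n)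
    (z z' : Multiset (Multiset G)) (k : ℕ) (hz : ∀ A ∈ z, IsMinZeroSum A)
    (hz' : ∀ A ∈ z', IsMinZeroSum A) (hs : z'.sum = z.sum) (hk : card z ≤ k)
    (hk' : k + (n - 2) ≤ card z')
    (hgap : ∀ t ∈ zeroSumLengths z.sum, t ≤ k ∨ k + (n - 2) ≤ t) :
    ∃ (g : G) (y : Multiset (Multiset G)), addOrderOf g = n ∧ (∀ A ∈ y, IsMinZeroSum A) ∧
      y.sum + (replicate n g + replicate n (-g)) = z.sum ∧ card y + 2 = k := by
  -- The lower bound on `card z'` is an inequality because the factorization that replaces `z'` in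
  -- the induction may be longer than needed.
  induction z using Multiset.induction_on generalizing z' k with
  | empty =>
    have h0 : z' ≠ 0 := by rintro rfl; rw [card_zero] at hk'; omega
    obtain ⟨A, hA⟩ := Multiset.exists_mem_of_ne_zero h0
    have h1 := Multiset.le_sum_of_mem hA
    rw [hs, sum_zero] at h1
    exact absurd (Multiset.le_zero.1 h1) (hz' A hA).1
  | cons U z ih =>
    have hU := hz U (mem_cons_self _ _)
    rw [card_cons] at hk
    rw [sum_cons] at hs
    obtain ⟨t, ht, hUt, htc, hmeet⟩ := exists_le_le_sum z' U (hs ▸ Multiset.le_add_right _ _)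
    obtain ⟨r, rfl⟩ := Multiset.le_iff_exists_add.1 ht
    have htm : ∀ V ∈ t, IsMinZeroSum V := fun V hV => hz' V (mem_add.2 (Or.inl hV))
    have hrm : ∀ V ∈ r, IsMinZeroSum V := fun V hV => hz' V (mem_add.2 (Or.inr hV))
    obtain ⟨R, hR⟩ := Multiset.le_iff_exists_add.1 hUt
    have hts := sum_sum_eq_zero fun V hV => (htm V hV).2.1
    obtain ⟨w, hw, hws⟩ := exists_sum_eq_of_sum_eq_zero R (by
      rw [hR, sum_add, hU.2.1, zero_add] at hts; exact hts)
    have hwrm : ∀ V ∈ w + r, IsMinZeroSum V := by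
      intro V hV
      rcases mem_add.1 hV with h | h
      exacts [hw V h, hrm V h]
    have hwrs : (w + r).sum = z.sum := by
      rw [sum_add, hR, ← hws, add_assoc] at hs
      rw [sum_add]
      exact add_left_cancel hs
    have hlen := add_mem_zeroSumLengths hU.one_mem_zeroSumLengths (card_mem_zeroSumLengths hwrm)
    rw [hwrs, ← sum_cons, card_add] at hlen
    rw [card_add] at hk'
    rcases hgap _ hlen with hle | hge
    -- From `1 + |w| + |r| ≤ k` and `|t| + |r| ≥ k + n - 2` follows `|t| ≥ |w| + n - 1`, while `|t|
    -- ≤ |U| ≤ n`. As `w` is nonempty, `|w| = 1` and `|t| = |U| = n`.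
    · have hUc := hU.card_le
      have hw0 : card w ≠ 0 := by
        intro h0
        rw [← hws, Multiset.card_eq_zero.1 h0, sum_zero, add_zero] at hR
        have := hU.card_eq_one_of_sum_eq htm hR
        omega
      obtain ⟨W, rfl⟩ := Multiset.card_eq_one.1 (show card w = 1 by omega)
      rw [sum_singleton] at hws
      subst hws
      obtain ⟨g, hg, hgt⟩ := exists_generator_of_exchange hn hcard hU (hw W (by simp)) (by omega)
        htm (by omega) hmeet hR
      refine ⟨g, r, hg, hrm, ?_, ?_⟩
      · rw [sum_cons, ← hs, sum_add, hgt, add_comm]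
      · rw [card_singleton] at hle; omega
    -- The new factorization is still beyond the gap, and cancelling `U` shifts all the bounds down
    -- by one.
    · obtain ⟨g, y, hg, hy, hys, hyc⟩ := ih (w + r) (k - 1) (fun A hA => hz A (mem_cons_of_mem hA))
        hwrm hwrs (by omega) (by rw [card_add]; omega) (by
          intro s hs
          have := hgap _ (by
            rw [sum_cons]; exact add_mem_zeroSumLengths hU.one_mem_zeroSumLengths hs)
          omega)
      refine ⟨g, U ::ₘ y, hg, ?_, ?_, ?_⟩
      · intro A hA
        rcases mem_cons.1 hA with rfl | hA
        exacts [hU, hy A hA]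
      · rw [sum_cons, sum_cons, add_assoc, hys]
      · rw [card_cons]; omega

/-! ### Lengths modulo `n - 2` over `{0, g, -g}` -/

/-- The witness `e` is the number of atoms `gⁿ` minus the number of atoms `(-g)ⁿ`. It is determined
by the product, so the divisibility fixes `card z` modulo `n - 2`. Both formulas are additive and
are checked on the four possible atoms. -/
theorem exists_excess [DecidableEq G] {g : G} {n : ℕ} (hn : 3 ≤ n) (hg : addOrderOf g = n)
    (z : Multiset (Multiset G)) (hz : ∀ A ∈ z, IsMinZeroSum A)
    (hsupp : ∀ x ∈ z.sum, x = 0 ∨ x = g ∨ x = -g) :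
    ∃ e : ℤ, (n : ℤ) * e = z.sum.count g - z.sum.count (-g) ∧
      ((n - 2 : ℕ) : ℤ) ∣ card z + e - z.sum.count 0 - z.sum.count g := by
  have hg0 := ne_zero_of_addOrderOf hn hg
  have hgn := ne_neg_of_addOrderOf hn hg
  induction z using Multiset.induction_on with
  | empty => exact ⟨0, by simp, by simp⟩
  | cons A z ih =>
    have hA := hz A (mem_cons_self _ _)
    rw [sum_cons] at hsupp
    have hsA : ∀ x ∈ A, x = 0 ∨ x = g ∨ x = -g := fun x hx => hsupp x (mem_add.2 (Or.inl hx))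
    obtain ⟨e, he, hdvd⟩ := ih (fun B hB => hz B (mem_cons_of_mem hB))
      (fun x hx => hsupp x (mem_add.2 (Or.inr hx)))
    have key : ∃ f : ℤ, (n : ℤ) * f = A.count g - A.count (-g) ∧
        ((n - 2 : ℕ) : ℤ) ∣ 1 + f - A.count 0 - A.count g := by
      by_cases h0 : (0 : G) ∈ A
      · rw [hA.eq_singleton_zero h0]
        exact ⟨0, by simp [hg0], by simp [hg0]⟩
      have rep : ∀ h : G, addOrderOf h = n → (∀ x ∈ A, x = h) → A = replicate n h := by
        intro h hh hall
        have hrep := Multiset.eq_replicate_card.2 hall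
        have hm : card A • h = 0 := by
          have := hA.2.1
          rwa [hrep, sum_replicate] at this
        have hle := Nat.le_of_dvd (Multiset.card_pos.2 hA.1) (addOrderOf_dvd_of_nsmul_eq_zero hm)
        have hmin := IsMinZeroSum.of_replicate (g := h) (by omega)
        rw [← hA.eq_of_le (B := replicate (addOrderOf h) h) (by
          rw [hrep]; exact (replicate_le_replicate _).2 hle) hmin.1 hmin.2.1, hh]
      by_cases h1 : g ∈ A
      · by_cases h2 : -g ∈ A
        · rw [hA.pair hgn h1 h2]
          exact ⟨0, by simp [hgn, hgn.symm],
            by simp [hgn, hg0, hg0.symm]⟩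
        · rw [rep g hg fun x hx => by
            rcases hsA x hx with rfl | rfl | rfl
            exacts [absurd hx h0, rfl, absurd hx h2]]
          -- For `gⁿ` the expression is `1 + 1 - n = -(n - 2)`; for the other three atoms it is `0`.
          refine ⟨1, by simp [count_replicate, hgn], -1, ?_⟩
          simp [count_replicate, hg0]
          push_cast [Nat.cast_sub (show 2 ≤ n by omega)]
          ring
      · rw [rep (-g) (by rwa [addOrderOf_neg]) fun x hx => by
          rcases hsA x hx with rfl | rfl | rfl
          exacts [absurd hx h0, absurd hx h1, rfl]]
        refine ⟨-1, by simp [count_replicate, hgn.symm], ?_⟩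
        simp [count_replicate, hg0, hgn.symm]
    obtain ⟨f, hf, hfd⟩ := key
    refine ⟨e + f, ?_, ?_⟩
    · rw [mul_add, he, hf, sum_cons, count_add, count_add]
      push_cast; ring
    · have := Int.dvd_add hdvd hfd
      rw [sum_cons, count_add, count_add, card_cons]
      convert this using 1
      push_cast; ring

theorem dvd_sub_of_mem_zeroSumLengths {g : G} {n : ℕ} (hn : 3 ≤ n) (hg : addOrderOf g = n)
    {B : Multiset G} (hsupp : ∀ x ∈ B, x = 0 ∨ x = g ∨ x = -g) {j k : ℕ}
    (hj : j ∈ zeroSumLengths B) (hk : k ∈ zeroSumLengths B) :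
    ((n - 2 : ℕ) : ℤ) ∣ (k : ℤ) - j := by
  classical
  obtain ⟨y, hy, rfl, rfl⟩ := hj
  obtain ⟨z, hz, hzs, rfl⟩ := hk
  obtain ⟨e, he, hed⟩ := exists_excess hn hg y hy hsupp
  obtain ⟨f, hf, hfd⟩ := exists_excess hn hg z hz (by rwa [hzs])
  rw [hzs] at hf hfd
  have hef : e = f := by
    have : (n : ℤ) * e = n * f := by rw [he, hf]
    exact mul_left_cancel₀ (by positivity) this
  subst hef
  convert Int.dvd_sub hfd hed using 1
  ring

/-- If two consecutive lengths of a zero-sum sequence over a group of order `n` differ by `n - 2`,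
then all lengths are congruent modulo `n - 2`. -/
theorem dvd_sub_of_gap [Finite G] {n : ℕ} (hn : 3 ≤ n) (hcard : Nat.card G = n) {B : Multiset G}
    {m : ℕ} (hm : m ∈ zeroSumLengths B) (hm' : m + (n - 2) ∈ zeroSumLengths B)
    (hgap : ∀ k, m < k → k < m + (n - 2) → k ∉ zeroSumLengths B) {j k : ℕ}
    (hj : j ∈ zeroSumLengths B) (hk : k ∈ zeroSumLengths B) :
    ((n - 2 : ℕ) : ℤ) ∣ (k : ℤ) - j := by
  obtain ⟨z, hz, rfl, rfl⟩ := hm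
  obtain ⟨z', hz', hs, hc⟩ := hm'
  have hgap' : ∀ t ∈ zeroSumLengths z.sum, t ≤ card z ∨ card z + (n - 2) ≤ t := by
    intro t ht
    by_contra! hlt
    exact hgap t hlt.1 hlt.2 ht
  obtain ⟨g, y, hg, hy, hys, hyc⟩ := exists_generator_of_gap hn hcard z z' (card z) hz hz' hs le_rfl
    hc.ge hgap'
  refine dvd_sub_of_mem_zeroSumLengths hn hg ?_ hj hk
  intro x hx
  rw [← hys] at hx
  rcases mem_add.1 hx with hx | hx
  · obtain ⟨A, hA, hxA⟩ := (Multiset.mem_join (S := y)).1 hx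
    refine (hy A hA).mem_eq_of_lengths hn hcard hg ?_ hxA
    obtain ⟨y, rfl⟩ := Multiset.exists_cons_of_mem hA
    intro t ht
    -- The atoms of `y` other than `A` number `card z - 3`, so the gap from `card z` to `card z + (n
    -- - 2)` becomes the gap from `3` to `n + 1`.
    have h1 := add_mem_zeroSumLengths (card_mem_zeroSumLengths
      fun C hC => hy C (mem_cons_of_mem hC)) ht
    rw [← add_assoc, add_comm y.sum, ← sum_cons, hys] at h1
    have := hgap' _ h1
    rw [card_cons] at hyc
    omega
  · rcases mem_add.1 hx with hx | hx
    · exact Or.inr (Or.inl (eq_of_mem_replicate hx))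
    · exact Or.inr (Or.inr (eq_of_mem_replicate hx))

end KrullMonoid

theorem corollary3p3 {M : Type*} [CancelCommMonoid M] {P : Type*}
    (φ : KrullMonoid.DivisorTheory M P) (n : ℕ) (hn : 3 ≤ n)
    (hcyc : IsCyclic φ.ClassGroup) (hcard : Nat.card φ.ClassGroup = n)
    (T : Set ℕ) (hT : T.Nonempty) (hTsub : T ⊆ Set.Icc 1 (n - 2))
    (hmem : n - 2 ∈ T) (hne : T ≠ {n - 2}) :
    ¬ KrullMonoid.IsRealizable M T := by
  rintro ⟨x, rfl⟩
  have hx : ¬ IsUnit x := by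
    intro hx
    rw [KrullMonoid.deltaSet_eq_empty_of_isUnit hx] at hT
    exact Set.not_nonempty_empty hT
  have hcard' : Nat.card (Additive φ.ClassGroup) = n := hcard
  have : Finite (Additive φ.ClassGroup) := Nat.finite_of_card_ne_zero (by omega)
  have hL := φ.isTransfer_classSeq.lengthSet_eq hx
  obtain ⟨-, m, hm, hm', hgap⟩ := id hmem
  rw [hL] at hm hm' hgap
  refine hne (Set.Subset.antisymm ?_ (Set.singleton_subset_iff.2 hmem))
  intro d hd
  have hd' := hTsub hd
  obtain ⟨hd0, j, hj, hj', -⟩ := hd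
  rw [hL] at hj hj'
  have hdvd := KrullMonoid.dvd_sub_of_gap hn hcard' hm hm' hgap hj hj'
  push_cast at hdvd
  rw [add_sub_cancel_left, Int.natCast_dvd_natCast] at hdvd
  exact Nat.le_antisymm hd'.2 (Nat.le_of_dvd hd0 hdvd)
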